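/- Let $m\ge 1$, $a_1,\dots,a_m\in\mathbb R^n$, $b_1,\dots,b_m\in\{0,1\}$, $\mu>0$, and let $$f(x)=\frac1m\sum_{i=1}^m\Big(\ln\big(1+e^{\langle a_i,x\rangle}\big)-b_i\langle a_i,x\rangle\Big)+\frac{\mu}{2}\|x\|^2$$ be the $\ell_2$-regularized logistic regression objective. Let $\lambda>0$, $q\in[0,1)$, and consider $\min_{x\in\mathbb R^n} F(x):=f(x)+\lambda\|x\|_q^q$, where $\|x\|_q^q=\sum_i|x_i|^q$ (the number of non-zero entries if $q=0$). **Notation.** For an index set $T$ put $E(x;T):=f(x)+\lambda\sum_{i\in T}|x_i|^q$. For a function $g$, $\partial^2 g(x)$ is the generalized Hessian, the convex hull of all limits of $\nabla^2 g(x^i)$ along sequences $x^i\to x$ of points of twice differentiability. For $S=\mathrm{supp}(x)$, let $\partial^2_S E(x)$ be the set of principal submatrices $H_S$ (rows and columns in $S$) with $H\in\partial^2E(\cdot\,;S)(x)$, and $\nabla_SE(x):=(\nabla E(\cdot\,;S)(x))_S$. **Algorithm (PSNP).** Let $\sigma>0$, $\gamma\in(0,1)$, $\tau>0$ and $x^0\in\mathbb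 R^n$. The step size is a constant $\alpha$ with $0<\alpha\le\min\{\tau,\frac1{\sigma+\sigma_0}\}$, where $\sigma_0$ is either a constant for which $f$ is $\sigma_0$-strongly smooth, i.e. $f(x)\le f(w)+\langle\nabla f(w),x-w\rangle+\frac{\sigma_0}{2}\|x-w\|^2$ for all $x,w$, or $\sigma_0=\sup\{\|H\|:H\in\partial^2f(x),\ \|x\|^2<c_0\}$ with $c_0=\sup\{5(\|x\|^2+\tau^2\|\nabla f(x)\|^2+\tau\lambda\|x\|_q^q):F(x)\le F(x^0)\}$. For $k=0,1,2,\dots$: 1. choose $w^k\in\operatorname{argmin}_w\ \frac12\|w-(x^k-\alpha\nabla f(x^k))\|^2+\alpha\lambda\|w\|_q^q$ and put $S^k=\mathrm{supp}(w^k)$; 2. choose $M^k\in\partial^2_{S^k}E(w^k)$. If the equations $M^kd^k_{S^k}=\nabla_{S^k}E(w^k)$, $d^k_i=0$ for $i\notin S^k$, have a solution $d^k$ (any one, if there are several) for which $F(w^k-\gamma^{s}d^k)\le F(w^k)-\frac\sigma2\|\gamma^{s}d^k\|^2$ for some $s\in\{0,1,2,\dots\}$, let $s_k$ be the smallest such $s$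 and $x^{k+1}=w^k-\gamma^{s_k}d^k$. Otherwise (no solution exists, or the chosen one fails the test for every $s$) let $x^{k+1}=w^k$. **Claim.** Let $x^*$ be an accumulation point of $\{x^k\}$ and $S^*=\mathrm{supp}(x^*)$. Suppose the second-order sufficient condition $\langle Mv,v\rangle>0$ holds for all $M\in\partial^2_{S^*}E(x^*)$ and all $0\ne v\in\mathbb R^{|S^*|}$, and that $0<\sigma<\sigma_*$, where $$\sigma_*:=\tfrac12\inf_{M\in\partial^2_{S^*}E(x^*)}\ \inf_{\|v\|=1}\langle Mv,v\rangle$$ ($\sigma_*=+\infty$ if $x^*=0$). Then the following hold. * $F(w^k)\le F(x^k)-\frac\sigma2\|w^k-x^k\|^2$ for every $k$, so the sufficient decrease demanded of the proximal step by PSNP is satisfied. * The whole sequence converges: $x^k\to x^*$. * $x^*$ is a unique local minimizer of $F$, in the sense that there are $\eta>0$ and a neighbourhood $N$ of $x^*$ with $F(x)\ge F(x^*)+\eta\|x-x^*\|^2$ for all $x\in N$. * The convergence is quadratic: there is $C>0$ with $\|x^{k+1}-x^*\|\le C\|x^k-x^*\|^2$ for all sufficiently large $k$. -/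

import Mathlib

open Filter Topology Matrix

namespace PSNP

noncomputable section

/-- `ℝⁿ` with the Euclidean norm. -/
abbrev Vec (n : ℕ) := EuclideanSpace ℝ (Fin n)

/-- The scalar function `t ↦ |t|^q`, `0 ≤ q < 1`, with the convention that for `q = 0` it is the
indicator of `t ≠ 0`. (For `q > 0` the value at `t = 0` is `0` as well.) -/
def absPow (q t : ℝ) : ℝ := if t = 0 then 0 else |t| ^ q

/-- `‖x_T‖_q^q = ∑_{i ∈ T} |x_i|^q`. -/
def lqOn {n : ℕ} (q : ℝ) (T : Finset (Fin n)) (x : Vec n) : ℝ := ∑ i ∈ T, absPow q (x i)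

/-- `‖x‖_q^q = ∑_i |x_i|^q`; for `q = 0` the number of non-zero entries of `x`. -/
def lq {n : ℕ} (q : ℝ) (x : Vec n) : ℝ := lqOn q Finset.univ x

/-- The objective `F(x) = f(x) + λ ‖x‖_q^q`. -/
def objF {n : ℕ} (f : Vec n → ℝ) (lam q : ℝ) (x : Vec n) : ℝ := f x + lam * lq q x

/-- The function `E(x; T) = f(x) + λ ‖x_T‖_q^q`. -/
def objE {n : ℕ} (f : Vec n → ℝ) (lam q : ℝ) (T : Finset (Fin n)) (x : Vec n) : ℝ :=
  f x + lam * lqOn q T x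

/-- The support of a vector. -/
def supp {n : ℕ} (x : Vec n) : Finset (Fin n) := Finset.univ.filter fun i => x i ≠ 0

/-- The proximal operator: the set of minimizers of `w ↦ ½‖x - w‖² + r(w)`. -/
def prox {n : ℕ} (r : Vec n → ℝ) (x : Vec n) : Set (Vec n) :=
  {w | ∀ z, 1 / 2 * ‖x - w‖ ^ 2 + r w ≤ 1 / 2 * ‖x - z‖ ^ 2 + r z}

/-- `f` is twice differentiable at `x`. -/
def TwiceDiffAt {n : ℕ} (f : Vec n → ℝ) (x : Vec n) : Prop :=
  (∀ᶠ y in 𝓝 x, DifferentiableAt ℝ f y) ∧ DifferentiableAt ℝ (gradient f) x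

/-- The Hessian matrix of `f` at `x`: the Jacobian matrix of the gradient. -/
def hess {n : ℕ} (f : Vec n → ℝ) (x : Vec n) : Matrix (Fin n) (Fin n) ℝ :=
  Matrix.of fun i j => (fderiv ℝ (gradient f) x (EuclideanSpace.single j 1)) i

/-- The generalized Hessian `∂²f(x)`: the convex hull of all limits of Hessian matrices `∇²f(xⁱ)`
along sequences `xⁱ → x` of points at which `f` is twice differentiable. -/
def genHess {n : ℕ} (f : Vec n → ℝ) (x : Vec n) : Set (Matrix (Fin n) (Fin n) ℝ) :=
  convexHull ℝ {H | ∃ y : ℕ → Vec n, Tendsto y atTop (𝓝 x) ∧ (∀ i, TwiceDiffAt f (y i)) ∧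
    Tendsto (fun i => hess f (y i)) atTop (𝓝 H)}

/-- `∂²_S E(x)`, `S = supp x`: the principal submatrices with rows and columns in `S` of the
elements of the generalized Hessian of `E(·; S)` at `x`. -/
def genHessE {n : ℕ} (f : Vec n → ℝ) (lam q : ℝ) (x : Vec n) :
    Set (Matrix (supp x) (supp x) ℝ) :=
  (fun H => H.submatrix Subtype.val Subtype.val) '' genHess (objE f lam q (supp x)) x

/-- The second-order sufficient condition at `x`. -/
def SecondOrderSufficient {n : ℕ} (f : Vec n → ℝ) (lam q : ℝ) (x : Vec n) : Prop :=
  ∀ M ∈ genHessE f lam q x, ∀ v : supp x → ℝ, v ≠ 0 → 0 < (M *ᵥ v) ⬝ᵥ v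

/-- `σ_* = ½ inf_M inf_{‖v‖ = 1} ⟨M v, v⟩`, the infimum over `M ∈ ∂²_S E(x)`, `S = supp x`, and over
the Euclidean unit sphere of `ℝ^S`, taken in the extended reals (it is `+∞` if `x = 0`). -/
def sigmaStar {n : ℕ} (f : Vec n → ℝ) (lam q : ℝ) (x : Vec n) : EReal :=
  ⨅ M ∈ genHessE f lam q x, ⨅ v ∈ {v : supp x → ℝ | v ⬝ᵥ v = 1},
    ((1 / 2 * ((M *ᵥ v) ⬝ᵥ v) : ℝ) : EReal)

/-- `x` is a unique local minimizer of `F`, in the sense of quadratic growth: there are `η > 0` and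
a neighbourhood of `x` on which `F(y) ≥ F(x) + η ‖y - x‖²`. -/
def IsUniqueLocalMinimizer {n : ℕ} (F : Vec n → ℝ) (x : Vec n) : Prop :=
  ∃ η : ℝ, 0 < η ∧ ∀ᶠ y in 𝓝 x, F x + η * ‖y - x‖ ^ 2 ≤ F y

/-- `d` solves the Newton equations `M d_S = ∇_S E(w)`, `d_{Sᶜ} = 0`, where `S = supp w`. -/
def IsNewtonDirection {n : ℕ} (f : Vec n → ℝ) (lam q : ℝ) (w : Vec n)
    (M : Matrix (supp w) (supp w) ℝ) (d : Vec n) : Prop :=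
  (M *ᵥ (fun i : supp w => d i) = fun i : supp w => gradient (objE f lam q (supp w)) w i) ∧
    ∀ i, i ∉ supp w → d i = 0

/-- The exponents `s ∈ {0, 1, 2, …}` that pass the sufficient decrease test of the Newton phase:
`F(w - γ^s d) ≤ F(w) - (σ/2) ‖γ^s d‖²`. -/
def newtonExponents {n : ℕ} (f : Vec n → ℝ) (lam q σ γ : ℝ) (w d : Vec n) : Set ℕ :=
  {s | objF f lam q (w - γ ^ s • d) ≤ objF f lam q w - σ / 2 * ‖γ ^ s • d‖ ^ 2}

/-- One iteration `x ↦ w ↦ x'` of PSNP with step size `α`. The point `w` is any element of the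
proximal set. Then some `M ∈ ∂²_S E(w)`, `S = supp w`, is chosen. If the Newton equations have a
solution `d` and some exponent passes the test, the smallest such `s` gives `x' = w - γ^s d`;
otherwise `x' = w`. If there are several solutions, any of them may be the one that is tested.
The sufficient decrease of the proximal phase is not required here: the step size rule ensures it,
and it is part of the conclusion of the theorem. -/
def IsStep {n : ℕ} (f : Vec n → ℝ) (lam q σ γ α : ℝ) (x w x' : Vec n) : Prop :=
  w ∈ prox (fun z => α * lam * lq q z) (x - α • gradient f x) ∧
  ∃ M ∈ genHessE f lam q w,
    (∃ d, IsNewtonDirection f lam q w M d ∧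
      ∃ s, IsLeast (newtonExponents f lam q σ γ w d) s ∧ x' = w - γ ^ s • d) ∨
    (((¬ ∃ d, IsNewtonDirection f lam q w M d) ∨
        ∃ d, IsNewtonDirection f lam q w M d ∧ newtonExponents f lam q σ γ w d = ∅) ∧
      x' = w)

/-- `f` is `L`-strongly smooth on `ℝⁿ`. -/
def IsStronglySmooth {n : ℕ} (L : ℝ) (f : Vec n → ℝ) : Prop :=
  ∀ x w : Vec n, f x ≤ f w + inner ℝ (gradient f w) (x - w) + L / 2 * ‖x - w‖ ^ 2

/-- `c₀ = sup { 5 (‖x‖² + τ² ‖∇f(x)‖² + τ λ ‖x‖_q^q) : F(x) ≤ F(x⁰) }`. -/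
def c0 {n : ℕ} (f : Vec n → ℝ) (lam q τ : ℝ) (x0 : Vec n) : ℝ :=
  sSup ((fun x => 5 * (‖x‖ ^ 2 + τ ^ 2 * ‖gradient f x‖ ^ 2 + τ * lam * lq q x)) ''
    {x | objF f lam q x ≤ objF f lam q x0})

/-- `σ₀ = sup { ‖H‖ : H ∈ ∂²f(x), ‖x‖² < c₀ }`, with the spectral norm of matrices. -/
def sigma0 {n : ℕ} (f : Vec n → ℝ) (lam q τ : ℝ) (x0 : Vec n) : ℝ :=
  sSup {r | ∃ x : Vec n, ‖x‖ ^ 2 < c0 f lam q τ x0 ∧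
    ∃ H ∈ genHess f x, r = ‖Matrix.toEuclideanCLM (𝕜 := ℝ) H‖}

/-- The `ℓ₂`-regularized logistic regression objective. -/
def flr {n m : ℕ} (a : Fin m → Vec n) (b : Fin m → ℝ) (μ : ℝ) (x : Vec n) : ℝ :=
  1 / (m : ℝ) * ∑ i, (Real.log (1 + Real.exp (inner ℝ (a i) x)) - b i * inner ℝ (a i) x) +
    μ / 2 * ‖x‖ ^ 2

end

end PSNP

/-! Near zero, λ|t|^q beats every linear function, so a proximal point cannot have tiny non-zero
entries: along the algorithm all non-zero entries of all w^k are at least one constant c in modulus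
(`exists_le_abs_of_mem_prox`). Hence supp w^k = supp x* as soon as w^k is close to x*
(`eventually_supp_eq`). On that coordinate subspace F coincides with E(·; supp x*), which is smooth
near x* with Hessian at least 2σ there, and the local analysis is that of Newton's method.

Sufficient decrease makes F(x^k) nonincreasing and w^k - x^k tend to 0, so x* is stationary for E on
its support. By `LocalControl.newton_step` the full Newton step passes the test near x* and ‖x^{k+1}
- x*‖ ≤ C‖w^k - x*‖², with at least halving. Halving traps the sequence near x*, which gives
convergence of the whole sequence (`tendsto_of_mapClusterPt_of_contraction`).

Quadratic growth (`isUniqueLocalMinimizer_of_localControl`) combines convexity on the support with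
the steep penalty off it. It also replaces w^k by x^k in the rate: η‖w^k - x*‖² ≤ F(w^k) - F(x*) ≤
F(x^k) - F(x*) ≤ (L/2)‖x^k - x*‖².

Sufficient decrease itself is the descent lemma with constant σ₀; when σ₀ is the supremum over a
ball, `le_taylor_sigma0` checks that the proximal segment stays in that ball. -/

namespace PSNP

open scoped InnerProductSpace

/-! ### Taylor estimates and the Newton step for C³ functions -/

section Calculus

/-- A function on `[0, 1]` whose second derivative is at most `K` lies below its Taylor parabola. -/
lemma le_taylor_two_of_deriv_le {φ φ' φ'' : ℝ → ℝ} {K : ℝ}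
    (h1 : ∀ t ∈ Set.Icc (0 : ℝ) 1, HasDerivAt φ (φ' t) t)
    (h2 : ∀ t ∈ Set.Icc (0 : ℝ) 1, HasDerivAt φ' (φ'' t) t)
    (hK : ∀ t ∈ Set.Ioo (0 : ℝ) 1, φ'' t ≤ K) : φ 1 ≤ φ 0 + φ' 0 + K / 2 := by
  have key : ∀ (g g' : ℝ → ℝ), (∀ t ∈ Set.Icc (0 : ℝ) 1, HasDerivAt g (g' t) t) →
      (∀ t ∈ Set.Ioo (0 : ℝ) 1, g' t ≤ 0) → AntitoneOn g (Set.Icc 0 1) := by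
    intro g g' hg hg'
    refine antitoneOn_of_deriv_nonpos (convex_Icc 0 1)
      (fun t ht => (hg t ht).continuousAt.continuousWithinAt) ?_ ?_
    · intro t ht
      rw [interior_Icc] at ht
      exact (hg t (Set.Ioo_subset_Icc_self ht)).differentiableAt.differentiableWithinAt
    · intro t ht
      rw [interior_Icc] at ht
      rw [(hg t (Set.Ioo_subset_Icc_self ht)).deriv]
      exact hg' t ht
  have h0 : (0 : ℝ) ∈ Set.Icc (0 : ℝ) 1 := by simp
  have a1 := key (fun t => φ' t - K * t) (fun t => φ'' t - K)
    (fun t ht => ((h2 t ht).sub ((hasDerivAt_id t).const_mul K)).congr_deriv (by simp))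
    (fun t ht => by linarith [hK t ht])
  have a2 := key (fun t => φ t - φ' 0 * t - K / 2 * t ^ 2) (fun t => φ' t - φ' 0 - K * t)
    (fun t ht => by
      have := ((h1 t ht).sub ((hasDerivAt_id t).const_mul (φ' 0))).sub
        ((hasDerivAt_pow 2 t).const_mul (K / 2))
      refine this.congr_deriv ?_
      simp; ring)
    (fun t ht => by
      have := a1 h0 (Set.Ioo_subset_Icc_self ht) ht.1.le
      simp only [mul_zero, sub_zero] at this
      linarith)
  have := a2 h0 (by simp : (1 : ℝ) ∈ Set.Icc (0 : ℝ) 1) zero_le_one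
  simp only [mul_zero, mul_one, sub_zero, one_pow] at this
  norm_num at this
  linarith

lemma line_mem_ball {X : Type*} [NormedAddCommGroup X] [NormedSpace ℝ X] {x y z : X} {r : ℝ}
    (hy : y ∈ Metric.ball x r) (hz : z ∈ Metric.ball x r) {t : ℝ}
    (ht : t ∈ Set.Icc (0 : ℝ) 1) : y + t • (z - y) ∈ Metric.ball x r :=
  (convex_ball x r).add_smul_sub_mem hy hz ht

variable {X : Type*} [NormedAddCommGroup X] [InnerProductSpace ℝ X] [CompleteSpace X]

/-- The Hessian of `f` at `x` as a continuous linear operator. -/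
noncomputable abbrev hessOp (f : X → ℝ) (x : X) : X →L[ℝ] X := fderiv ℝ (gradient f) x

lemma contDiffAt_gradient {f : X → ℝ} {x : X} {k l : WithTop ℕ∞} (hf : ContDiffAt ℝ k f x)
    (hkl : l + 1 ≤ k) : ContDiffAt ℝ l (gradient f) x :=
  ((InnerProductSpace.toDual ℝ X).symm.contDiff.contDiffAt).comp x (hf.fderiv_right hkl)

lemma inner_gradient {f : X → ℝ} {x : X} (v : X) : ⟪gradient f x, v⟫_ℝ = fderiv ℝ f x v := by
  simp [gradient]

lemma hasDerivAt_line {f : X → ℝ} {x v : X} {t : ℝ} (hf : DifferentiableAt ℝ f (x + t • v)) :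
    HasDerivAt (fun s : ℝ => f (x + s • v)) ⟪gradient f (x + t • v), v⟫_ℝ t := by
  rw [inner_gradient]
  have h : HasDerivAt (fun s : ℝ => x + s • v) v t := by
    simpa using ((hasDerivAt_id t).smul_const v).const_add x
  exact hf.hasFDerivAt.comp_hasDerivAt t h

lemma hasDerivAt_gradient_line {f : X → ℝ} {x v : X} {t : ℝ}
    (hf : DifferentiableAt ℝ (gradient f) (x + t • v)) :
    HasDerivAt (fun s : ℝ => ⟪gradient f (x + s • v), v⟫_ℝ)
      ⟪hessOp f (x + t • v) v, v⟫_ℝ t := by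
  have h : HasDerivAt (fun s : ℝ => x + s • v) v t := by
    simpa using ((hasDerivAt_id t).smul_const v).const_add x
  have h2 := hf.hasFDerivAt.comp_hasDerivAt t h
  simpa using h2.inner ℝ (hasDerivAt_const t v)

/-- The curvature bound is asked only on the open segment; `le_taylor_sigma0` needs this, since an
endpoint may lie on the boundary of the ball defining σ₀. -/
lemma le_taylor_two {f : X → ℝ} {x v : X} {K : ℝ}
    (hf : ∀ t ∈ Set.Icc (0 : ℝ) 1, ContDiffAt ℝ 2 f (x + t • v))
    (hK : ∀ t ∈ Set.Ioo (0 : ℝ) 1, ⟪hessOp f (x + t • v) v, v⟫_ℝ ≤ K) :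
    f (x + v) ≤ f x + ⟪gradient f x, v⟫_ℝ + K / 2 := by
  simpa using le_taylor_two_of_deriv_le
    (fun t ht => hasDerivAt_line ((hf t ht).differentiableAt (by norm_num)))
    (fun t ht => hasDerivAt_gradient_line
      ((contDiffAt_gradient (l := 1) (hf t ht) (by norm_num)).differentiableAt (by norm_num))) hK

lemma taylor_two_le {f : X → ℝ} {x v : X} {K : ℝ}
    (hf : ∀ t ∈ Set.Icc (0 : ℝ) 1, ContDiffAt ℝ 2 f (x + t • v))
    (hK : ∀ t ∈ Set.Ioo (0 : ℝ) 1, K ≤ ⟪hessOp f (x + t • v) v, v⟫_ℝ) :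
    f x + ⟪gradient f x, v⟫_ℝ + K / 2 ≤ f (x + v) := by
  have := le_taylor_two_of_deriv_le (K := -K)
    (fun t ht => (hasDerivAt_line ((hf t ht).differentiableAt (by norm_num))).neg)
    (fun t ht => (hasDerivAt_gradient_line
      ((contDiffAt_gradient (l := 1) (hf t ht) (by norm_num)).differentiableAt (by norm_num))).neg)
    (fun t ht => neg_le_neg (hK t ht))
  simp only [one_smul, zero_smul, add_zero, Pi.neg_apply] at this
  linarith

/-- Quantitative `C³` control of `f` on a ball around `x`: the Hessian is bounded and Lipschitz, and
quadratic forms that are bounded below by `2 σ` at `x` stay bounded below by `3 σ / 2`. -/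
structure LocalControl (f : X → ℝ) (x : X) (V : Submodule ℝ X) (σ r L : ℝ) : Prop where
  r_pos : 0 < r
  L_pos : 0 < L
  contDiffAt : ∀ y ∈ Metric.ball x r, ContDiffAt ℝ 3 f y
  coercive : ∀ y ∈ Metric.ball x r, ∀ v ∈ V, 3 / 2 * σ * ‖v‖ ^ 2 ≤ ⟪hessOp f y v, v⟫_ℝ
  lipschitz : ∀ y ∈ Metric.ball x r, ∀ z ∈ Metric.ball x r,
    ‖hessOp f y - hessOp f z‖ ≤ L * ‖y - z‖
  bounded : ∀ y ∈ Metric.ball x r, ‖hessOp f y‖ ≤ L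
  bounded_gradient : ∀ y ∈ Metric.ball x r, ‖gradient f y‖ ≤ L

/-- The Hessian is C¹ at `x`, hence locally Lipschitz; keeping it within σ/2 of its value at `x`
costs the drop from 2σ to 3σ/2. One `L` serves for all three bounds, so it is taken as their sum. -/
lemma exists_localControl {f : X → ℝ} {x : X} {V : Submodule ℝ X} {σ : ℝ} (hσ : 0 < σ)
    (hf : ContDiffAt ℝ 3 f x) (hV : ∀ v ∈ V, 2 * σ * ‖v‖ ^ 2 ≤ ⟪hessOp f x v, v⟫_ℝ) :
    ∃ r L, LocalControl f x V σ r L := by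
  have hG : ContDiffAt ℝ 2 (gradient f) x := contDiffAt_gradient hf (by norm_num)
  have hA : ContDiffAt ℝ 1 (hessOp f) x := hG.fderiv_right (by norm_num)
  obtain ⟨K, t, ht, hK⟩ := hA.exists_lipschitzOnWith
  have e1 : ∀ᶠ y in 𝓝 x, ContDiffAt ℝ 3 f y := hf.eventually (by simp)
  have e2 : ∀ᶠ y in 𝓝 x, ‖gradient f y‖ < ‖gradient f x‖ + 1 :=
    hG.continuousAt.norm.eventually (gt_mem_nhds (by linarith))
  have e3 : ∀ᶠ y in 𝓝 x, ‖hessOp f y‖ < ‖hessOp f x‖ + 1 :=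
    hA.continuousAt.norm.eventually (gt_mem_nhds (by linarith))
  have e4 : ∀ᶠ y in 𝓝 x, ‖hessOp f y - hessOp f x‖ < σ / 2 := by
    have : Tendsto (fun y => ‖hessOp f y - hessOp f x‖) (𝓝 x) (𝓝 0) := by
      simpa using ((hA.continuousAt.sub (continuousAt_const (y := hessOp f x))).norm).tendsto
    exact this.eventually (gt_mem_nhds (by linarith))
  obtain ⟨r, hr, H⟩ := Metric.eventually_nhds_iff_ball.1
    (e1.and (e2.and (e3.and (e4.and ht))))
  refine ⟨r, K + (‖gradient f x‖ + 1) + (‖hessOp f x‖ + 1), hr, by positivity,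
    fun y hy => (H y hy).1, ?_, ?_, ?_, ?_⟩
  · intro y hy v hv
    have h1 := hV v hv
    have h2 : |⟪(hessOp f y - hessOp f x) v, v⟫_ℝ| ≤ σ / 2 * ‖v‖ ^ 2 := by
      refine (abs_real_inner_le_norm _ _).trans ?_
      have := ((hessOp f y - hessOp f x).le_opNorm v).trans
        (mul_le_mul_of_nonneg_right (H y hy).2.2.2.1.le (norm_nonneg v))
      nlinarith [norm_nonneg v]
    rw [_root_.sub_apply, inner_sub_left] at h2
    linarith [(abs_le.1 h2).1]
  · intro y hy z hz
    have := hK.norm_sub_le (H y hy).2.2.2.2 (H z hz).2.2.2.2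
    refine this.trans (mul_le_mul_of_nonneg_right ?_ (norm_nonneg _))
    linarith [norm_nonneg (gradient f x), norm_nonneg (hessOp f x)]
  · intro y hy
    linarith [(H y hy).2.2.1, norm_nonneg (gradient f x), K.coe_nonneg]
  · intro y hy
    linarith [(H y hy).2.1, norm_nonneg (hessOp f x), K.coe_nonneg]

namespace LocalControl

variable {f : X → ℝ} {x : X} {V : Submodule ℝ X} {σ r L : ℝ}

lemma strong_convexity (h : LocalControl f x V σ r L) {y z : X} (hy : y ∈ Metric.ball x r)
    (hz : z ∈ Metric.ball x r) (hV : z - y ∈ V) :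
    f y + ⟪gradient f y, z - y⟫_ℝ + 3 / 4 * σ * ‖z - y‖ ^ 2 ≤ f z := by
  have := taylor_two_le (f := f) (x := y) (v := z - y) (K := 3 / 2 * σ * ‖z - y‖ ^ 2)
    (fun t ht => (h.contDiffAt _ (line_mem_ball hy hz ht)).of_le (by norm_num))
    (fun t ht => h.coercive _ (line_mem_ball hy hz (Set.Ioo_subset_Icc_self ht)) _ hV)
  rw [add_sub_cancel] at this
  linarith

lemma smoothness (h : LocalControl f x V σ r L) {y z : X} (hy : y ∈ Metric.ball x r)
    (hz : z ∈ Metric.ball x r) :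
    f z ≤ f y + ⟪gradient f y, z - y⟫_ℝ + L / 2 * ‖z - y‖ ^ 2 := by
  have := le_taylor_two (f := f) (x := y) (v := z - y) (K := L * ‖z - y‖ ^ 2)
    (fun t ht => (h.contDiffAt _ (line_mem_ball hy hz ht)).of_le (by norm_num))
    (fun t ht => by
      refine (real_inner_le_norm _ _).trans ?_
      have h1 := (hessOp f (y + t • (z - y))).le_of_opNorm_le
        (h.bounded _ (line_mem_ball hy hz (Set.Ioo_subset_Icc_self ht))) (z - y)
      nlinarith [norm_nonneg (z - y)])
  rw [add_sub_cancel] at this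
  linarith

lemma lipschitz_value (h : LocalControl f x V σ r L) {y z : X} (hy : y ∈ Metric.ball x r)
    (hz : z ∈ Metric.ball x r) : |f z - f y| ≤ L * ‖z - y‖ := by
  refine (convex_ball x r).norm_image_sub_le_of_norm_fderiv_le (𝕜 := ℝ) (f := f)
    (fun p hp => (h.contDiffAt p hp).differentiableAt (by norm_num)) (fun p hp => ?_) hy hz
  have := h.bounded_gradient p hp
  rwa [gradient, LinearIsometryEquiv.norm_map] at this

/-- Mean value inequality for the gradient minus its linearization at `y`: on the segment the
Hessian moves by at most L‖z - y‖. -/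
lemma gradient_taylor (h : LocalControl f x V σ r L) {y z : X} (hy : y ∈ Metric.ball x r)
    (hz : z ∈ Metric.ball x r) :
    ‖gradient f z - gradient f y - hessOp f y (z - y)‖ ≤ L * ‖z - y‖ ^ 2 := by
  have hd : ∀ p ∈ segment ℝ y z, p ∈ Metric.ball x r := fun p hp =>
    (convex_ball x r).segment_subset hy hz hp
  have := (convex_segment y z).norm_image_sub_le_of_norm_fderiv_le' (𝕜 := ℝ) (f := gradient f)
    (φ := hessOp f y) (C := L * ‖z - y‖)
    (fun p hp => (contDiffAt_gradient (l := 1) (h.contDiffAt p (hd p hp))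
      (by norm_num)).differentiableAt (by norm_num))
    (fun p hp => (h.lipschitz p (hd p hp) y hy).trans (by
      have : ‖p - y‖ ≤ ‖z - y‖ := by
        obtain ⟨t, ht, rfl⟩ := (segment_eq_image' ℝ y z ▸ hp :)
        rw [add_sub_cancel_left, norm_smul, Real.norm_of_nonneg ht.1]
        exact mul_le_of_le_one_left (norm_nonneg _) ht.2
      exact mul_le_mul_of_nonneg_left this h.L_pos.le))
    (left_mem_segment ℝ y z) (right_mem_segment ℝ y z)
  linarith [this, sq ‖z - y‖]

/-- The Newton step restricted to `V`: quadratic contraction and sufficient decrease. -/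
lemma newton_step (h : LocalControl f x V σ r L) (hσ : 0 < σ)
    (hx : ∀ v ∈ V, ⟪gradient f x, v⟫_ℝ = 0) :
    ∃ δ C, 0 < δ ∧ 0 < C ∧ ∀ w, ‖w - x‖ < δ → w - x ∈ V → ∀ d ∈ V,
      (∀ v ∈ V, ⟪hessOp f w d, v⟫_ℝ = ⟪gradient f w, v⟫_ℝ) →
      ‖w - d - x‖ ≤ C * ‖w - x‖ ^ 2 ∧ C * ‖w - x‖ ≤ 1 / 2 ∧
        f (w - d) ≤ f w - σ / 2 * ‖d‖ ^ 2 := by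
  have hL := h.L_pos
  have hr := h.r_pos
  set C := L / σ with hC
  have hCpos : 0 < C := by positivity
  -- The second bound gives the contraction factor 1/2; the third, with ‖d‖ ≤ 2‖e‖, bounds the cubic
  -- remainder L‖d‖³ by (σ/4)‖d‖².
  refine ⟨min r (min (1 / (2 * C)) (σ / (8 * L))), C, by positivity, hCpos, ?_⟩
  intro w hw hwV d hd hN
  obtain ⟨hw1, hw2⟩ := lt_min_iff.1 hw
  obtain ⟨hw2, hw3⟩ := lt_min_iff.1 hw2
  have hxB : x ∈ Metric.ball x r := Metric.mem_ball_self hr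
  have hwB : w ∈ Metric.ball x r := by rwa [mem_ball_iff_norm]
  set e := w - x with he
  have hCe : C * ‖e‖ ≤ 1 / 2 := by
    rw [lt_div_iff₀ (by positivity)] at hw2
    linarith
  have hLe : L * ‖e‖ ≤ σ / 8 := by
    rw [lt_div_iff₀ (by positivity)] at hw3
    linarith
  have hdeV : d - e ∈ V := V.sub_mem hd hwV
  have hde : ‖d - e‖ ≤ C * ‖e‖ ^ 2 := by
    have h1 := h.coercive w hwB _ hdeV
    have h2 := h.gradient_taylor hwB hxB
    -- Tested on V, the Newton equation turns the Hessian at `w` applied to `d` into the gradient at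
    -- `w`, and the gradient at `x` vanishes; what remains is the Taylor remainder.
    have h3 : ⟪hessOp f w (d - e), d - e⟫_ℝ
        = - ⟪gradient f x - gradient f w - hessOp f w (x - w), d - e⟫_ℝ := by
      rw [map_sub, inner_sub_left, hN _ hdeV, inner_sub_left, inner_sub_left, hx _ hdeV,
        ← neg_sub w x, map_neg, inner_neg_left]
      ring
    have h4 := (neg_le_abs _).trans (abs_real_inner_le_norm
      (gradient f x - gradient f w - hessOp f w (x - w)) (d - e))
    rw [← h3, norm_sub_rev x w, ← he] at *
    have h5 : σ * ‖d - e‖ ^ 2 ≤ L * ‖e‖ ^ 2 * ‖d - e‖ := by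
      nlinarith [mul_le_mul_of_nonneg_right h2 (norm_nonneg (d - e)), norm_nonneg (d - e),
        sq_nonneg ‖d - e‖, mul_nonneg hσ.le (sq_nonneg ‖d - e‖)]
    rcases (norm_nonneg (d - e)).eq_or_lt with h0 | h0
    · rw [← h0]; positivity
    · rw [hC, div_mul_eq_mul_div, le_div_iff₀ hσ]
      refine le_of_mul_le_mul_right ?_ h0
      linarith
  have hp : w - d - x = -(d - e) := by rw [he]; abel
  have hpn : ‖w - d - x‖ ≤ C * ‖e‖ ^ 2 := by rwa [hp, norm_neg]
  have hpe : C * ‖e‖ ^ 2 ≤ ‖e‖ := by nlinarith [norm_nonneg e]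
  have hpB : w - d ∈ Metric.ball x r := by
    rw [mem_ball_iff_norm]; linarith
  refine ⟨hpn, hCe, ?_⟩
  have hdn : ‖d‖ ≤ 2 * ‖e‖ := by
    have := norm_add_le (d - e) e
    rw [sub_add_cancel] at this
    linarith
  have hwd : w - (w - d) = d := by abel
  have hdw : w - d - w = -d := by abel
  -- Strong convexity based at the new point yields a decrease of (3σ/4)‖d‖². The gradient there,
  -- tested on `d`, is only a Taylor remainder and costs at most (σ/4)‖d‖².
  have s1 := h.strong_convexity hpB hwB (by rwa [hwd])
  have s2 := h.gradient_taylor hwB hpB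
  rw [hwd] at s1
  rw [hdw, norm_neg] at s2
  have s3 : ⟪gradient f (w - d), d⟫_ℝ
      = ⟪gradient f (w - d) - gradient f w - hessOp f w (-d), d⟫_ℝ := by
    rw [inner_sub_left, inner_sub_left, map_neg, inner_neg_left, hN d hd]; ring
  have s4 := (neg_le_abs _).trans (abs_real_inner_le_norm
    (gradient f (w - d) - gradient f w - hessOp f w (-d)) d)
  have s5 := mul_le_mul_of_nonneg_right s2 (norm_nonneg d)
  have s6 : L * ‖d‖ ^ 2 * ‖d‖ ≤ σ / 4 * ‖d‖ ^ 2 := by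
    have : L * ‖d‖ ≤ σ / 4 := by nlinarith
    nlinarith [sq_nonneg ‖d‖]
  rw [s3] at s1
  nlinarith [sq_nonneg ‖d‖]

end LocalControl

end Calculus

/-! ### The scalar penalty |t|^q -/

section AbsPow

lemma absPow_zero (q : ℝ) : absPow q 0 = 0 := by simp [absPow]

lemma absPow_of_ne {q t : ℝ} (ht : t ≠ 0) : absPow q t = |t| ^ q := by simp [absPow, ht]

lemma absPow_nonneg (q t : ℝ) : 0 ≤ absPow q t := by
  unfold absPow; split_ifs <;> positivity

lemma absPow_le {q : ℝ} (hq0 : 0 ≤ q) (hq1 : q < 1) (t : ℝ) : absPow q t ≤ 1 + |t| := by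
  unfold absPow
  split_ifs with h
  · positivity
  · rcases le_total |t| 1 with h1 | h1
    · linarith [Real.rpow_le_one (abs_nonneg t) h1 hq0, abs_nonneg t]
    · have := Real.rpow_le_rpow_of_exponent_le h1 hq1.le
      rw [Real.rpow_one] at this
      linarith

lemma contDiffAt_absPow (q : ℝ) {t : ℝ} (ht : t ≠ 0) (k : ℕ∞) :
    ContDiffAt ℝ k (absPow q) t := by
  have h : ContDiffAt ℝ k (fun s : ℝ => |s| ^ q) t :=
    (contDiffAt_abs ht).rpow_const_of_ne (abs_ne_zero.2 ht)
  refine h.congr_of_eventuallyEq ?_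
  filter_upwards [isOpen_ne.mem_nhds ht] with s hs
  exact absPow_of_ne hs

/-- Near zero `|t|^q` dominates every linear function. -/
lemma exists_mul_abs_lt_absPow {q : ℝ} (hq1 : q < 1) (K : ℝ) {ν : ℝ} (hν : 0 < ν) :
    ∃ c > 0, ∀ t : ℝ, t ≠ 0 → |t| < c → K * |t| < ν * absPow q t := by
  have hq : 0 < 1 - q := by linarith
  have hc : Tendsto (fun t : ℝ => K * |t| ^ (1 - q)) (𝓝 0) (𝓝 0) := by
    have : Continuous fun t : ℝ => K * |t| ^ (1 - q) :=
      continuous_const.mul (continuous_abs.rpow_const fun _ => Or.inr hq.le)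
    simpa [Real.zero_rpow hq.ne'] using this.tendsto 0
  obtain ⟨c, hc, H⟩ := Metric.eventually_nhds_iff.1 (hc.eventually (gt_mem_nhds hν))
  refine ⟨c, hc, fun t ht htc => ?_⟩
  have h1 := H (y := t) (by simpa using htc)
  have h2 : |t| = |t| ^ (1 - q) * |t| ^ q := by
    rw [← Real.rpow_add (abs_pos.2 ht)]; simp
  rw [absPow_of_ne ht]
  calc K * |t| = K * |t| ^ (1 - q) * |t| ^ q := by rw [mul_assoc, ← h2]
    _ < ν * |t| ^ q := by
      exact mul_lt_mul_of_pos_right h1 (Real.rpow_pos_of_pos (abs_pos.2 ht) q)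

end AbsPow

/-! ### The penalty on vectors and coordinate subspaces -/

section Lq

variable {n : ℕ}

lemma mem_supp {x : Vec n} {i : Fin n} : i ∈ supp x ↔ x i ≠ 0 := by simp [supp]

lemma lqOn_nonneg (q : ℝ) (T : Finset (Fin n)) (x : Vec n) : 0 ≤ lqOn q T x :=
  Finset.sum_nonneg fun _ _ => absPow_nonneg _ _

lemma lq_nonneg (q : ℝ) (x : Vec n) : 0 ≤ lq q x := lqOn_nonneg _ _ _

lemma lq_le {q : ℝ} (hq0 : 0 ≤ q) (hq1 : q < 1) (x : Vec n) : lq q x ≤ n * (1 + ‖x‖) := by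
  have : ∀ i ∈ Finset.univ, absPow q (x i) ≤ 1 + ‖x‖ := fun i _ =>
    (absPow_le hq0 hq1 _).trans (by linarith [PiLp.norm_apply_le x i, Real.norm_eq_abs (x i)])
  simpa [lq, lqOn, mul_add] using Finset.sum_le_card_nsmul _ _ _ this

lemma lq_eq_add_compl (q : ℝ) (S : Finset (Fin n)) (x : Vec n) :
    lq q x = lqOn q S x + lqOn q Sᶜ x := (Finset.sum_add_sum_compl S _).symm

/-- The vectors supported in `S`. -/
def supportedIn (S : Finset (Fin n)) : Submodule ℝ (Vec n) where
  carrier := {v | ∀ i ∉ S, v i = 0}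
  add_mem' ha hb i hi := by simp [ha i hi, hb i hi]
  zero_mem' i _ := by simp
  smul_mem' c v hv i hi := by simp [hv i hi]

lemma mem_supportedIn_supp (x : Vec n) : x ∈ supportedIn (supp x) := fun i hi => by
  simpa [mem_supp] using hi

lemma lq_eq_lqOn (q : ℝ) {S : Finset (Fin n)} {x : Vec n} (hx : x ∈ supportedIn S) :
    lq q x = lqOn q S x := by
  rw [lq_eq_add_compl q S, add_eq_left]
  exact Finset.sum_eq_zero fun i hi => by
    rw [hx i (Finset.mem_compl.1 hi), absPow_zero]

lemma objF_eq_objE (f : Vec n → ℝ) (lam q : ℝ) {S : Finset (Fin n)} {x : Vec n}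
    (hx : x ∈ supportedIn S) : objF f lam q x = objE f lam q S x := by
  rw [objF, objE, lq_eq_lqOn q hx]

/-- Penalizing only coordinates that are non-zero at `x` avoids the singularity of |t|^q at 0. -/
lemma contDiffAt_objE {f : Vec n → ℝ} (hf : ContDiff ℝ 3 f) (lam q : ℝ) {S : Finset (Fin n)}
    {x : Vec n} (hx : ∀ i ∈ S, x i ≠ 0) : ContDiffAt ℝ 3 (objE f lam q S) x := by
  unfold objE lqOn
  refine hf.contDiffAt.add (contDiffAt_const.mul (ContDiffAt.sum fun i hi => ?_))
  exact ContDiffAt.comp (g := absPow q) (f := fun y : Vec n => y i) x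
    (contDiffAt_absPow q (hx i hi) 3)
    (EuclideanSpace.proj i : Vec n →L[ℝ] ℝ).contDiff.contDiffAt

lemma inner_eq_sum (u v : Vec n) : ⟪u, v⟫_ℝ = ∑ i, u i * v i := by
  simp [PiLp.inner_apply, mul_comm]

lemma sum_supportedIn {S : Finset (Fin n)} {v : Vec n} (hv : v ∈ supportedIn S) (g : Fin n → ℝ) :
    ∑ i, g i * v i = ∑ i : S, g i * v i := by
  rw [Finset.sum_coe_sort S fun i => g i * v i]
  refine (Finset.sum_subset (Finset.subset_univ S) fun i _ hi => ?_).symm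
  rw [hv i hi, mul_zero]

/-- Extension by zero of a vector indexed by `S`. -/
noncomputable def extendZero {S : Finset (Fin n)} (v : S → ℝ) : Vec n :=
  WithLp.toLp 2 fun i => if h : i ∈ S then v ⟨i, h⟩ else 0

lemma extendZero_apply {S : Finset (Fin n)} (v : S → ℝ) (i : S) : extendZero v i = v i := by
  simp [extendZero]

lemma extendZero_mem {S : Finset (Fin n)} (v : S → ℝ) : extendZero v ∈ supportedIn S := by
  intro i hi
  simp [extendZero, hi]

end Lq

/-! ### Generalized Hessians and the Newton equations -/

section GenHess

variable {n : ℕ}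

lemma continuousAt_hess {f : Vec n → ℝ} {x : Vec n} (hf : ContDiffAt ℝ 2 f x) :
    ContinuousAt (hess f) x := by
  have h : ContinuousAt (hessOp f) x :=
    ((contDiffAt_gradient (l := 1) hf (by norm_num)).fderiv_right (m := 0)
      (by norm_num)).continuousAt
  refine continuousAt_pi.2 fun i => continuousAt_pi.2 fun j => ?_
  exact (EuclideanSpace.proj i : Vec n →L[ℝ] ℝ).continuous.continuousAt.comp
    (h.clm_apply continuousAt_const)

lemma twiceDiffAt_of_contDiffAt {f : Vec n → ℝ} {x : Vec n} (hf : ContDiffAt ℝ 2 f x) :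
    TwiceDiffAt f x :=
  ⟨(hf.eventually (by simp)).mono fun _ h => h.differentiableAt (by norm_num),
    (contDiffAt_gradient (l := 1) hf (by norm_num)).differentiableAt (by norm_num)⟩

/-- Continuity of the Hessian leaves only one possible limit, so the choice of M^k in the algorithm
is forced. -/
lemma genHess_eq_singleton {f : Vec n → ℝ} {x : Vec n} (hf : ContDiffAt ℝ 2 f x) :
    genHess f x = {hess f x} := by
  have : {H | ∃ y : ℕ → Vec n, Tendsto y atTop (𝓝 x) ∧ (∀ i, TwiceDiffAt f (y i)) ∧
      Tendsto (fun i => hess f (y i)) atTop (𝓝 H)} = {hess f x} := by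
    ext H
    constructor
    · rintro ⟨y, hy, -, hH⟩
      exact tendsto_nhds_unique hH ((continuousAt_hess hf).tendsto.comp hy)
    · rintro rfl
      exact ⟨fun _ => x, tendsto_const_nhds, fun _ => twiceDiffAt_of_contDiffAt hf,
        tendsto_const_nhds⟩
  rw [genHess, this, convexHull_singleton]

lemma hess_mulVec (f : Vec n → ℝ) (x v : Vec n) (i : Fin n) :
    ∑ j, hess f x i j * v j = hessOp f x v i := by
  have hv : v = ∑ j, v j • EuclideanSpace.single j (1 : ℝ) := by
    ext i
    simp [Finset.sum_apply, Pi.single_apply]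
  conv_rhs => rw [hv, map_sum]
  simp [hess, mul_comm]

lemma toEuclideanCLM_hess (f : Vec n → ℝ) (x : Vec n) :
    Matrix.toEuclideanCLM (𝕜 := ℝ) (hess f x) = hessOp f x := by
  ext v i
  rw [← hess_mulVec]
  simp [Matrix.mulVec, dotProduct]

lemma submatrix_hess_mulVec (f : Vec n → ℝ) (x : Vec n) {S : Finset (Fin n)} {v : Vec n}
    (hv : v ∈ supportedIn S) (i : S) :
    ((hess f x).submatrix (Subtype.val : S → Fin n) (Subtype.val : S → Fin n) *ᵥ
      fun j : S => v j) i = hessOp f x v i := by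
  rw [← hess_mulVec, sum_supportedIn hv]
  simp [Matrix.mulVec, dotProduct]

lemma submatrix_hess_quadratic (f : Vec n → ℝ) (x : Vec n) {S : Finset (Fin n)} {v : Vec n}
    (hv : v ∈ supportedIn S) :
    ((hess f x).submatrix (Subtype.val : S → Fin n) (Subtype.val : S → Fin n) *ᵥ
      fun j : S => v j) ⬝ᵥ (fun j : S => v j) = ⟪hessOp f x v, v⟫_ℝ := by
  rw [inner_eq_sum, sum_supportedIn hv, dotProduct]
  exact Finset.sum_congr rfl fun i _ => by rw [submatrix_hess_mulVec f x hv]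

lemma genHessE_eq_singleton {f : Vec n → ℝ} (hf : ContDiff ℝ 3 f) (lam q : ℝ) (x : Vec n) :
    genHessE f lam q x =
      {(hess (objE f lam q (supp x)) x).submatrix Subtype.val Subtype.val} := by
  rw [genHessE, genHess_eq_singleton ((contDiffAt_objE hf lam q fun i hi =>
    mem_supp.1 hi).of_le (by norm_num)), Set.image_singleton]

/-- The hypothesis `σ < σ_*` bounds the Hessian of `E(·; S)` from below on vectors supported
in `S`. -/
lemma le_inner_hessOp_of_lt_sigmaStar {f : Vec n → ℝ} (hf : ContDiff ℝ 3 f) {lam q σ : ℝ}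
    {x : Vec n} (hσ : (σ : EReal) < sigmaStar f lam q x) {v : Vec n}
    (hv : v ∈ supportedIn (supp x)) :
    2 * σ * ‖v‖ ^ 2 ≤ ⟪hessOp (objE f lam q (supp x)) x v, v⟫_ℝ := by
  rcases eq_or_ne v 0 with rfl | h0
  · simp
  have hn : 0 < ‖v‖ := norm_pos_iff.2 h0
  set u : Vec n := ‖v‖⁻¹ • v with hu
  have huS : u ∈ supportedIn (supp x) := Submodule.smul_mem _ _ hv
  have hu1 : (fun j : supp x => u j) ⬝ᵥ (fun j : supp x => u j) = 1 := by
    have h1 : ‖u‖ = 1 := by rw [hu, norm_smul, norm_inv, norm_norm, inv_mul_cancel₀ hn.ne']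
    have h2 := inner_eq_sum u u
    rw [real_inner_self_eq_norm_sq, h1, sum_supportedIn huS, one_pow] at h2
    exact h2.symm
  have h1 : (σ : EReal) < _ := hσ.trans_le ((iInf₂_le _ (by
    rw [genHessE_eq_singleton hf]; exact rfl)).trans (iInf₂_le (fun j : supp x => u j) hu1))
  rw [submatrix_hess_quadratic _ _ huS, EReal.coe_lt_coe_iff] at h1
  have h2 : ⟪hessOp (objE f lam q (supp x)) x u, u⟫_ℝ * ‖v‖ ^ 2
      = ⟪hessOp (objE f lam q (supp x)) x v, v⟫_ℝ := by
    rw [hu, map_smul, inner_smul_left, inner_smul_right]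
    simp only [conj_trivial]
    field_simp
  rw [← h2]
  exact mul_le_mul_of_nonneg_right (by linarith) (sq_nonneg _)

/-- Weak form of the matrix equations, as required by `LocalControl.newton_step`. -/
lemma IsNewtonDirection.mem_and_inner {f : Vec n → ℝ} (hf : ContDiff ℝ 3 f) {lam q : ℝ}
    {w d : Vec n} {M : Matrix (supp w) (supp w) ℝ} (hM : M ∈ genHessE f lam q w)
    (h : IsNewtonDirection f lam q w M d) : d ∈ supportedIn (supp w) ∧
      ∀ v ∈ supportedIn (supp w), ⟪hessOp (objE f lam q (supp w)) w d, v⟫_ℝ =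
        ⟪gradient (objE f lam q (supp w)) w, v⟫_ℝ := by
  refine ⟨h.2, fun v hv => ?_⟩
  rw [genHessE_eq_singleton hf, Set.mem_singleton_iff] at hM
  rw [inner_eq_sum, inner_eq_sum, sum_supportedIn hv, sum_supportedIn hv]
  refine Finset.sum_congr rfl fun i _ => ?_
  rw [← submatrix_hess_mulVec _ _ h.2, ← hM, h.1]

/-- A positive quadratic form makes the square matrix injective, hence surjective. -/
lemma exists_isNewtonDirection {f : Vec n → ℝ} (hf : ContDiff ℝ 3 f) {lam q : ℝ}
    {w : Vec n} {M : Matrix (supp w) (supp w) ℝ} (hM : M ∈ genHessE f lam q w)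
    (hpos : ∀ v ∈ supportedIn (supp w), v ≠ 0 →
      0 < ⟪hessOp (objE f lam q (supp w)) w v, v⟫_ℝ) :
    ∃ d, IsNewtonDirection f lam q w M d := by
  rw [genHessE_eq_singleton hf, Set.mem_singleton_iff] at hM
  have hinj : Function.Injective M.mulVec := by
    refine (injective_iff_map_eq_zero (Matrix.mulVecLin M)).2 fun v hv => ?_
    by_contra hne
    have h0 : extendZero v ≠ 0 := fun h => hne (funext fun i => by
      rw [← extendZero_apply v i, h]; rfl)
    have h1 := hpos _ (extendZero_mem v) h0
    rw [← submatrix_hess_quadratic _ _ (extendZero_mem v), ← hM] at h1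
    simp only [extendZero_apply] at h1
    rw [Matrix.mulVecLin_apply] at hv
    change 0 < (M *ᵥ v) ⬝ᵥ v at h1
    rw [hv] at h1
    simp at h1
  have hsurj := Matrix.mulVec_surjective_iff_isUnit.2 (Matrix.mulVec_injective_iff_isUnit.1 hinj)
  obtain ⟨d, hd⟩ := hsurj (fun i : supp w => gradient (objE f lam q (supp w)) w i)
  refine ⟨extendZero d, ?_, extendZero_mem d⟩
  simp only [extendZero_apply]
  exact hd

end GenHess

/-! ### Proximal points: decrease, size, lower bound on entries, stationarity -/

section Prox

variable {n : ℕ}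

/-- The competitor is `x` itself; the term ½α²‖∇f(x)‖² cancels. -/
lemma prox_inequality {f : Vec n → ℝ} {lam q α : ℝ} {x w : Vec n}
    (hw : w ∈ prox (fun z => α * lam * lq q z) (x - α • gradient f x)) :
    1 / 2 * ‖w - x‖ ^ 2 + α * ⟪gradient f x, w - x⟫_ℝ + α * lam * lq q w ≤ α * lam * lq q x := by
  have h := hw x
  have e1 : x - α • gradient f x - w = -((w - x) + α • gradient f x) := by abel
  have e2 : x - α • gradient f x - x = -(α • gradient f x) := by abel
  rw [e1, e2, norm_neg, norm_neg, norm_add_sq_real, inner_smul_right,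
    real_inner_comm] at h
  linarith

lemma objF_le_of_mem_prox {f : Vec n → ℝ} {lam q α σ σ₀ : ℝ} {x w : Vec n} (hα0 : 0 < α)
    (hα : α * (σ + σ₀) ≤ 1)
    (hw : w ∈ prox (fun z => α * lam * lq q z) (x - α • gradient f x))
    (hs : f w ≤ f x + ⟪gradient f x, w - x⟫_ℝ + σ₀ / 2 * ‖w - x‖ ^ 2) :
    objF f lam q w ≤ objF f lam q x - σ / 2 * ‖w - x‖ ^ 2 := by
  have h := prox_inequality hw
  have h2 := mul_le_mul_of_nonneg_left hs hα0.le
  have h3 := mul_le_mul_of_nonneg_right hα (sq_nonneg ‖w - x‖)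
  unfold objF
  refine le_of_mul_le_mul_left ?_ hα0
  linarith

/-- With b = α‖∇f(x)‖ and s the distance from the gradient point to `w`, comparison with `x` gives
s² ≤ b² + 2αλ‖x‖_q^q. The factor 5 comes from (‖x‖ + b + s)² ≤ 5‖x‖² + (5/2)(b² + s²). -/
lemma norm_sq_le_of_mem_prox {f : Vec n → ℝ} {lam q α : ℝ} {x w : Vec n} (hα0 : 0 < α)
    (hlam : 0 < lam) (hw : w ∈ prox (fun z => α * lam * lq q z) (x - α • gradient f x)) :
    ‖w‖ ^ 2 ≤ 5 * (‖x‖ ^ 2 + α ^ 2 * ‖gradient f x‖ ^ 2 + α * lam * lq q x) := by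
  have h := hw x
  have e2 : x - α • gradient f x - x = -(α • gradient f x) := by abel
  have hn : ‖α • gradient f x‖ = α * ‖gradient f x‖ := by
    rw [norm_smul, Real.norm_of_nonneg hα0.le]
  rw [e2, norm_neg, hn] at h
  have h0 : 0 ≤ α * lam * lq q w := mul_nonneg (by positivity) (lq_nonneg q w)
  have h1 : ‖w‖ ≤ ‖x‖ + α * ‖gradient f x‖ + ‖x - α • gradient f x - w‖ := by
    have e : w = x - α • gradient f x - (x - α • gradient f x - w) := by abel
    conv_lhs => rw [e]
    refine (norm_sub_le _ _).trans (add_le_add_left ?_ _)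
    rw [← hn]
    exact norm_sub_le _ _
  set s := ‖x - α • gradient f x - w‖
  set b := α * ‖gradient f x‖
  have h2 : ‖w‖ ^ 2 ≤ (‖x‖ + b + s) ^ 2 := pow_le_pow_left₀ (norm_nonneg w) h1 2
  have h3 : α ^ 2 * ‖gradient f x‖ ^ 2 = b ^ 2 := by simp only [b]; ring
  rw [h3]
  nlinarith [sq_nonneg (2 * ‖x‖ - b), sq_nonneg (2 * ‖x‖ - s), sq_nonneg (b - s)]

lemma lq_sub_single (q : ℝ) (w : Vec n) (i : Fin n) :
    lq q (w - w i • EuclideanSpace.single i 1) = lq q w - absPow q (w i) := by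
  unfold lq lqOn
  rw [← Finset.add_sum_erase _ _ (Finset.mem_univ i), ← Finset.add_sum_erase _ (fun j =>
    absPow q (w j)) (Finset.mem_univ i)]
  have : ∑ j ∈ Finset.univ.erase i, absPow q ((w - w i • EuclideanSpace.single i (1 : ℝ)) j)
      = ∑ j ∈ Finset.univ.erase i, absPow q (w j) :=
    Finset.sum_congr rfl fun j hj => by simp [(Finset.mem_erase.1 hj).1]
  rw [this]
  simp [absPow_zero]

/-- The non-zero entries of proximal points of a bounded set are bounded away from zero. -/
lemma exists_le_abs_of_mem_prox {q : ℝ} (hq1 : q < 1) {ν : ℝ} (hν : 0 < ν) (U : ℝ) :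
    ∃ c > 0, ∀ u w : Vec n, ‖u‖ ≤ U → w ∈ prox (fun z => ν * lq q z) u →
      ∀ i, w i ≠ 0 → c ≤ |w i| := by
  obtain ⟨c, hc, H⟩ := exists_mul_abs_lt_absPow hq1 U hν
  refine ⟨c, hc, fun u w hu hw i hi => ?_⟩
  by_contra hlt
  have h1 := H _ hi (not_le.1 hlt)
  -- Deleting coordinate `i` saves ν|w_i|^q and raises the quadratic term by at most U|w_i|.
  have h2 := hw (w - w i • EuclideanSpace.single i 1)
  have e : u - (w - w i • EuclideanSpace.single i 1)
      = (u - w) + w i • EuclideanSpace.single i (1 : ℝ) := by abel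
  simp only [lq_sub_single] at h2
  rw [e, norm_add_sq_real, inner_smul_right, EuclideanSpace.inner_single_right, norm_smul,
    PiLp.norm_single] at h2
  simp at h2
  have h3 : w i * u i ≤ |w i| * U :=
    (le_abs_self _).trans (by
      rw [abs_mul]
      exact mul_le_mul_of_nonneg_left
        (((Real.norm_eq_abs (u i)) ▸ PiLp.norm_apply_le u i).trans hu) (abs_nonneg _))
  nlinarith [sq_nonneg (w i)]

/-- First-order optimality of a proximal point on its support. -/
lemma inner_gradient_objE_of_mem_prox {f : Vec n → ℝ} (hf : ContDiff ℝ 3 f) {lam q α : ℝ}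
    {x w : Vec n}
    (hw : w ∈ prox (fun z => α * lam * lq q z) (x - α • gradient f x)) {v : Vec n}
    (hv : v ∈ supportedIn (supp w)) :
    α * ⟪gradient (objE f lam q (supp w)) w, v⟫_ℝ
      = ⟪α • (gradient f w - gradient f x) - (w - x), v⟫_ℝ := by
  set u := x - α • gradient f x with hu
  set E := objE f lam q (supp w) with hE
  have hEd : DifferentiableAt ℝ E (w + (0 : ℝ) • v) := by
    rw [zero_smul, add_zero]
    exact (contDiffAt_objE hf lam q fun i hi => mem_supp.1 hi).differentiableAt (by norm_num)
  have hfd : DifferentiableAt ℝ f (w + (0 : ℝ) • v) :=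
    (hf.differentiable (by norm_num)).differentiableAt
  have h1 : HasDerivAt (fun t : ℝ => 1 / 2 * ‖u - (w + t • v)‖ ^ 2) (-⟪u - w, v⟫_ℝ) 0 := by
    have h : HasDerivAt (fun s : ℝ => u - (w + s • v)) (-v) 0 := by
      simpa using (((hasDerivAt_id (0 : ℝ)).smul_const v).const_add w).const_sub u
    refine (h.norm_sq.const_mul (1 / 2)).congr_deriv ?_
    simp
  have h2 := h1.add (((hasDerivAt_line hEd).sub (hasDerivAt_line hfd)).const_mul α)
  -- Along directions in the support the penalty equals E - f, which is differentiable at `w`, so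
  -- Fermat's rule applies.
  have hmin : IsLocalMin ((fun t : ℝ => 1 / 2 * ‖u - (w + t • v)‖ ^ 2) + fun t : ℝ =>
      α * ((fun t : ℝ => E (w + t • v)) - fun t : ℝ => f (w + t • v)) t) 0 := by
    refine Eventually.of_forall fun t => ?_
    have h3 := hw (w + t • v)
    have hws := mem_supportedIn_supp w
    simp only [lq_eq_lqOn q hws,
      lq_eq_lqOn q ((supportedIn (supp w)).add_mem hws (Submodule.smul_mem _ t hv))] at h3
    simp only [hE, objE, Pi.add_apply, Pi.sub_apply, zero_smul, add_zero]
    linarith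
  have h3 := hmin.hasDerivAt_eq_zero h2
  rw [zero_smul, add_zero] at h3
  rw [inner_sub_left, inner_smul_left, inner_sub_left, inner_sub_left]
  rw [hu, inner_sub_left, inner_sub_left, inner_smul_left] at h3
  simp only [conj_trivial] at h3 ⊢
  linarith

end Prox

/-! ### The constants c₀ and σ₀ and the descent inequality -/

section StepSize

variable {n : ℕ}

lemma norm_le_of_objF_le {f : Vec n → ℝ} {μ lam q : ℝ} (hμ : 0 < μ) (hlam : 0 < lam)
    (hcoer : ∀ x, μ / 2 * ‖x‖ ^ 2 ≤ f x) {c : ℝ} {x : Vec n} (hx : objF f lam q x ≤ c) :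
    ‖x‖ ≤ √(2 / μ * c) := by
  refine Real.le_sqrt_of_sq_le ?_
  have h1 := hcoer x
  have h2 : 0 ≤ lam * lq q x := mul_nonneg hlam.le (lq_nonneg q x)
  have h3 : μ / 2 * ‖x‖ ^ 2 ≤ c := by unfold objF at hx; linarith
  rw [div_mul_eq_mul_div, le_div_iff₀ hμ]
  linarith

/-- Coercivity puts the level set in a ball, where the gradient is bounded. Without boundedness the
real `sSup` defining c₀ would carry no information. -/
lemma bddAbove_c0 {f : Vec n → ℝ} (hf : ContDiff ℝ 3 f) {μ lam q τ : ℝ} (hμ : 0 < μ)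
    (hlam : 0 < lam) (hq0 : 0 ≤ q) (hq1 : q < 1) (hτ : 0 < τ)
    (hcoer : ∀ x, μ / 2 * ‖x‖ ^ 2 ≤ f x) (x0 : Vec n) :
    BddAbove ((fun x => 5 * (‖x‖ ^ 2 + τ ^ 2 * ‖gradient f x‖ ^ 2 + τ * lam * lq q x)) ''
      {x | objF f lam q x ≤ objF f lam q x0}) := by
  have hG : Continuous (gradient f) := continuous_iff_continuousAt.2 fun x =>
    (contDiffAt_gradient (l := 2) hf.contDiffAt (by norm_num)).continuousAt
  set R := √(2 / μ * objF f lam q x0)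
  obtain ⟨C, hC⟩ := (isCompact_closedBall (0 : Vec n) R).exists_bound_of_continuousOn
    hG.continuousOn
  refine ⟨5 * (R ^ 2 + τ ^ 2 * C ^ 2 + τ * lam * (n * (1 + R))), ?_⟩
  rintro _ ⟨x, hx, rfl⟩
  have hxR : ‖x‖ ≤ R := norm_le_of_objF_le hμ hlam hcoer hx
  have h1 := hC x (by simpa using hxR)
  have h2 : lq q x ≤ n * (1 + R) := (lq_le hq0 hq1 x).trans (by gcongr)
  dsimp only
  gcongr

lemma le_sigma0_quadratic {f : Vec n → ℝ} (hf : ContDiff ℝ 3 f) {lam q τ : ℝ}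
    {x0 x : Vec n} (hx : ‖x‖ ^ 2 < c0 f lam q τ x0) (v : Vec n) :
    ⟪hessOp f x v, v⟫_ℝ ≤ sigma0 f lam q τ x0 * ‖v‖ ^ 2 := by
  have hH : ∀ x, genHess f x = {hess f x} := fun x =>
    genHess_eq_singleton (hf.contDiffAt.of_le (by norm_num))
  have hc : Continuous (hessOp f) := continuous_iff_continuousAt.2 fun x =>
    ((contDiffAt_gradient (l := 1) (k := 3) hf.contDiffAt (by norm_num)).fderiv_right (m := 0)
      (by norm_num)).continuousAt
  have hn : ‖hessOp f x‖ ≤ sigma0 f lam q τ x0 := by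
    refine le_csSup ?_ ⟨x, hx, hess f x, by rw [hH]; exact rfl, by rw [toEuclideanCLM_hess]⟩
    obtain ⟨C, hC⟩ := (isCompact_closedBall (0 : Vec n)
      (√(c0 f lam q τ x0))).exists_bound_of_continuousOn hc.continuousOn
    refine ⟨C, ?_⟩
    rintro _ ⟨y, hy, H, hyH, rfl⟩
    rw [hH, Set.mem_singleton_iff] at hyH
    rw [hyH, toEuclideanCLM_hess]
    exact hC y (by simpa using Real.le_sqrt_of_sq_le hy.le)
  refine (real_inner_le_norm _ _).trans ?_
  have := (hessOp f x).le_of_opNorm_le hn v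
  nlinarith [norm_nonneg v]

lemma le_taylor_sigma0 {f : Vec n → ℝ} (hf : ContDiff ℝ 3 f) {μ lam q τ α : ℝ} (hμ : 0 < μ)
    (hlam : 0 < lam) (hq0 : 0 ≤ q) (hq1 : q < 1) (hα0 : 0 < α) (hατ : α ≤ τ)
    (hcoer : ∀ x, μ / 2 * ‖x‖ ^ 2 ≤ f x) {x0 x w : Vec n}
    (hx : objF f lam q x ≤ objF f lam q x0)
    (hw : w ∈ prox (fun z => α * lam * lq q z) (x - α • gradient f x)) :
    f w ≤ f x + ⟪gradient f x, w - x⟫_ℝ + sigma0 f lam q τ x0 / 2 * ‖w - x‖ ^ 2 := by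
  have hτ : 0 < τ := hα0.trans_le hατ
  have hc : 5 * (‖x‖ ^ 2 + τ ^ 2 * ‖gradient f x‖ ^ 2 + τ * lam * lq q x) ≤ c0 f lam q τ x0 :=
    le_csSup (bddAbove_c0 hf hμ hlam hq0 hq1 hτ hcoer x0) ⟨x, hx, rfl⟩
  have hlx := lq_nonneg q x
  have hwc : ‖w‖ ^ 2 ≤ c0 f lam q τ x0 := by
    refine (norm_sq_le_of_mem_prox hα0 hlam hw).trans (le_trans ?_ hc)
    gcongr
  have hxc : 5 * ‖x‖ ^ 2 ≤ c0 f lam q τ x0 := by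
    have h1 : 0 ≤ τ ^ 2 * ‖gradient f x‖ ^ 2 := by positivity
    have h2 : 0 ≤ τ * lam * lq q x := by positivity
    linarith
  rcases eq_or_ne w x with rfl | hne
  · simp
  -- Positivity turns 5‖x‖² ≤ c₀ into ‖x‖² < c₀; then every point of the open segment satisfies the
  -- strict bound, even if ‖w‖² = c₀.
  have hpos : 0 < c0 f lam q τ x0 := by
    by_contra hle
    have h1 : ‖x‖ ^ 2 = 0 := le_antisymm (by linarith) (sq_nonneg _)
    have h2 : ‖w‖ ^ 2 = 0 := le_antisymm (by linarith) (sq_nonneg _)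
    rw [sq_eq_zero_iff, norm_eq_zero] at h1 h2
    exact hne (h2.trans h1.symm)
  have := le_taylor_two (f := f) (x := x) (v := w - x)
    (K := sigma0 f lam q τ x0 * ‖w - x‖ ^ 2)
    (fun t _ => hf.contDiffAt.of_le (by norm_num))
    (fun t ht => le_sigma0_quadratic hf (by
      have h1 : ‖x + t • (w - x)‖ ≤ (1 - t) * ‖x‖ + t * ‖w‖ := by
        have e : x + t • (w - x) = (1 - t) • x + t • w := by
          rw [smul_sub, sub_smul, one_smul]; abel
        rw [e]
        refine (norm_add_le _ _).trans (le_of_eq ?_)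
        rw [norm_smul, norm_smul, Real.norm_of_nonneg ht.1.le,
          Real.norm_of_nonneg (by linarith [ht.2])]
      have h2 := pow_le_pow_left₀ (norm_nonneg _) h1 2
      have h3 : ((1 - t) * ‖x‖ + t * ‖w‖) ^ 2 ≤ (1 - t) * ‖x‖ ^ 2 + t * ‖w‖ ^ 2 := by
        nlinarith [mul_nonneg (mul_nonneg ht.1.le (sub_nonneg.2 ht.2.le))
          (sq_nonneg (‖x‖ - ‖w‖))]
      nlinarith [ht.1, ht.2, sub_pos.2 ht.2]) _)
  rw [add_sub_cancel] at this
  linarith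

end StepSize

/-! ### Smoothness and coercivity of the logistic objective -/

section Logistic

variable {n m : ℕ}

lemma contDiff_flr (a : Fin m → Vec n) (b : Fin m → ℝ) (μ : ℝ) : ContDiff ℝ 3 (flr a b μ) := by
  have h : ∀ i, ContDiff ℝ 3 fun x : Vec n => inner ℝ (a i) x := fun i =>
    contDiff_const.inner ℝ contDiff_id
  unfold flr
  refine (contDiff_const.mul (ContDiff.sum fun i _ => ?_)).add
    (contDiff_const.mul (contDiff_norm_sq ℝ))
  exact ((contDiff_const.add (h i).exp).log fun x => by positivity).sub
    (contDiff_const.mul (h i))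

/-- Each loss term is nonnegative because ln(1 + e^t) ≥ max(0, t). -/
lemma le_flr (a : Fin m → Vec n) {b : Fin m → ℝ} (hb : ∀ i, b i = 0 ∨ b i = 1) (μ : ℝ)
    (x : Vec n) : μ / 2 * ‖x‖ ^ 2 ≤ flr a b μ x := by
  unfold flr
  refine le_add_of_nonneg_left (mul_nonneg (by positivity) (Finset.sum_nonneg fun i _ => ?_))
  set t := inner ℝ (a i) x
  have ht := Real.exp_pos t
  rcases hb i with h | h
  · rw [h, zero_mul, sub_zero]
    exact Real.log_nonneg (by linarith)
  · rw [h, one_mul, sub_nonneg, Real.le_log_iff_exp_le (by positivity)]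
    linarith

end Logistic

/-! ### Quadratic growth of F at a stationary point -/

section Growth

variable {n : ℕ}

/-- The restriction of a vector to the coordinates in `S`. -/
noncomputable def restrictTo (S : Finset (Fin n)) (y : Vec n) : Vec n :=
  WithLp.toLp 2 fun i => if i ∈ S then y i else 0

lemma restrictTo_mem (S : Finset (Fin n)) (y : Vec n) : restrictTo S y ∈ supportedIn S := by
  intro i hi
  simp [restrictTo, hi]

lemma norm_sub_restrictTo_le (S : Finset (Fin n)) (y : Vec n) :
    ‖y - restrictTo S y‖ ≤ ∑ i ∈ Sᶜ, |y i| := by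
  have h : y - restrictTo S y = ∑ i ∈ Sᶜ, y i • EuclideanSpace.single i (1 : ℝ) := by
    ext j
    simp [restrictTo, Finset.sum_apply, Pi.single_apply]
    split_ifs <;> simp
  rw [h]
  refine (norm_sum_le _ _).trans (Finset.sum_le_sum fun i _ => ?_)
  rw [norm_smul, PiLp.norm_single]
  simp

lemma norm_sq_restrictTo {S : Finset (Fin n)} {x : Vec n} (hx : x ∈ supportedIn S) (y : Vec n) :
    ‖y - x‖ ^ 2 = ‖restrictTo S y - x‖ ^ 2 + ‖y - restrictTo S y‖ ^ 2 := by
  have h : y - x = (restrictTo S y - x) + (y - restrictTo S y) := by abel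
  rw [h, norm_add_sq_real]
  have h0 : ⟪restrictTo S y - x, y - restrictTo S y⟫_ℝ = 0 := by
    rw [inner_eq_sum]
    refine Finset.sum_eq_zero fun i _ => ?_
    by_cases hi : i ∈ S
    · simp [restrictTo, hi]
    · simp [restrictTo, hi, hx i hi]
  rw [h0]
  ring

lemma isUniqueLocalMinimizer_of_localControl {f : Vec n → ℝ} {lam q σ r L : ℝ} {x : Vec n}
    (hq1 : q < 1) (hlam : 0 < lam) (hσ : 0 < σ)
    (h : LocalControl (objE f lam q (supp x)) x (supportedIn (supp x)) σ r L)
    (hx : ∀ v ∈ supportedIn (supp x), ⟪gradient (objE f lam q (supp x)) x, v⟫_ℝ = 0) :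
    IsUniqueLocalMinimizer (objF f lam q) x := by
  set S := supp x with hS
  have hxS : x ∈ supportedIn S := mem_supportedIn_supp x
  obtain ⟨c, hc, hlin⟩ := exists_mul_abs_lt_absPow hq1 (L + 1) hlam
  have hr := h.r_pos
  refine ⟨min (3 / 4 * σ) 1, by positivity, ?_⟩
  -- Of the slope L + 1 of the penalty off the support, L pays for the change of E between `z` and
  -- `y`; the rest leaves ‖y - z‖, which dominates ‖y - z‖² within radius 1.
  filter_upwards [Metric.ball_mem_nhds x (show 0 < min r (min c 1) by positivity)] with y hy
  rw [mem_ball_iff_norm] at hy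
  obtain ⟨hy1, hy2⟩ := lt_min_iff.1 hy
  obtain ⟨hy2, hy3⟩ := lt_min_iff.1 hy2
  have hpy := norm_sq_restrictTo hxS y
  set z := restrictTo S y with hz
  have hz1 : ‖z - x‖ ≤ ‖y - x‖ :=
    le_of_sq_le_sq (by nlinarith [sq_nonneg ‖y - z‖]) (norm_nonneg _)
  have hz2 : ‖y - z‖ ≤ ‖y - x‖ :=
    le_of_sq_le_sq (by nlinarith [sq_nonneg ‖z - x‖]) (norm_nonneg _)
  have hzV : z - x ∈ supportedIn S := Submodule.sub_mem _ (restrictTo_mem S y) hxS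
  have hyB : y ∈ Metric.ball x r := by rwa [mem_ball_iff_norm]
  have hzB : z ∈ Metric.ball x r := by rw [mem_ball_iff_norm]; linarith
  have h1 := (abs_le.1 (h.lipschitz_value hzB hyB)).1
  have h2 := h.strong_convexity (Metric.mem_ball_self hr) hzB hzV
  rw [hx _ hzV] at h2
  have h3 : (L + 1) * ‖y - z‖ ≤ lam * lqOn q Sᶜ y := by
    refine (mul_le_mul_of_nonneg_left (norm_sub_restrictTo_le S y)
      (by linarith [h.L_pos])).trans ?_
    rw [lqOn, Finset.mul_sum, Finset.mul_sum]
    refine Finset.sum_le_sum fun i hi => ?_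
    rcases eq_or_ne (y i) 0 with h0 | h0
    · rw [h0, absPow_zero, abs_zero, mul_zero, mul_zero]
    · refine (hlin _ h0 (lt_of_le_of_lt ?_ hy2)).le
      have := PiLp.norm_apply_le (y - x) i
      rwa [PiLp.sub_apply, hxS i (Finset.mem_compl.1 hi), sub_zero, Real.norm_eq_abs] at this
  have h4 : objF f lam q y = objE f lam q S y + lam * lqOn q Sᶜ y := by
    rw [objF, objE, lq_eq_add_compl q S]; ring
  rw [h4, objF_eq_objE f lam q hxS, hpy]
  have h5 := mul_le_mul_of_nonneg_right (min_le_left (3 / 4 * σ) 1) (sq_nonneg ‖z - x‖)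
  have h6 := mul_le_mul_of_nonneg_right (min_le_right (3 / 4 * σ) 1) (sq_nonneg ‖y - z‖)
  have h7 : ‖y - z‖ ^ 2 ≤ ‖y - z‖ := by nlinarith [norm_nonneg (y - z)]
  linarith

end Growth

/-! ### One iteration near the limit point -/

section Step

variable {n : ℕ} {f : Vec n → ℝ} {lam q σ γ α : ℝ}

/-- Continuity preserves the non-zero entries of `x`; the lower bound `c` excludes new ones. -/
lemma eventually_supp_eq (x : Vec n) {c : ℝ} (hc : 0 < c) :
    ∀ᶠ w in 𝓝 x, (∀ i, w i ≠ 0 → c ≤ |w i|) → supp w = supp x := by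
  have hcont : ∀ i, Tendsto (fun w : Vec n => w i) (𝓝 x) (𝓝 (x i)) := fun i =>
    (EuclideanSpace.proj i : Vec n →L[ℝ] ℝ).continuous.tendsto x
  have h : ∀ᶠ w in 𝓝 x, ∀ i, (x i ≠ 0 → w i ≠ 0) ∧ (x i = 0 → |w i| < c) := by
    refine eventually_all.2 fun i => ?_
    by_cases hi : x i = 0
    · have : ∀ᶠ w in 𝓝 x, |w i| < c :=
        (hcont i).abs.eventually (gt_mem_nhds (by simpa [hi] using hc))
      filter_upwards [this] with w hw
      exact ⟨fun h => absurd hi h, fun _ => hw⟩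
    · filter_upwards [(hcont i).eventually_ne hi] with w hw
      exact ⟨fun _ => hw, fun h => absurd h hi⟩
  filter_upwards [h] with w hw hwc
  ext i
  rw [mem_supp, mem_supp]
  refine ⟨fun hi h0 => ?_, fun hi => (hw i).1 hi⟩
  exact absurd ((hw i).2 h0) (not_lt.2 (hwc i hi))

lemma IsStep.objF_le {x w x' : Vec n} (hσ : 0 < σ) (h : IsStep f lam q σ γ α x w x') :
    objF f lam q x' ≤ objF f lam q w := by
  obtain ⟨-, M, -, ⟨d, -, s, hs, rfl⟩ | ⟨-, rfl⟩⟩ := h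
  · exact hs.1.trans (by have : 0 ≤ σ / 2 * ‖γ ^ s • d‖ ^ 2 := by positivity
                         linarith)
  · exact le_rfl

/-- Near a stationary point satisfying the second-order condition the full Newton step is taken and
contracts quadratically. -/
lemma exists_newton_contraction (hf : ContDiff ℝ 3 f) (hσ : 0 < σ) {xs : Vec n} {r L : ℝ}
    (h : LocalControl (objE f lam q (supp xs)) xs (supportedIn (supp xs)) σ r L)
    (hxs : ∀ v ∈ supportedIn (supp xs), ⟪gradient (objE f lam q (supp xs)) xs, v⟫_ℝ = 0) :
    ∃ C, 0 < C ∧ ∀ᶠ w in 𝓝 xs, supp w = supp xs → ∀ x x', IsStep f lam q σ γ α x w x' →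
      ‖x' - xs‖ ≤ C * ‖w - xs‖ ^ 2 ∧ ‖x' - xs‖ ≤ 1 / 2 * ‖w - xs‖ ∧
        x' ∈ supportedIn (supp xs) := by
  obtain ⟨δ, C, hδ, hC, H⟩ := h.newton_step hσ hxs
  refine ⟨C, hC, ?_⟩
  filter_upwards [Metric.ball_mem_nhds xs hδ, Metric.ball_mem_nhds xs h.r_pos] with w hw hwr
  intro hS x x' hstep
  rw [mem_ball_iff_norm] at hw
  have hwS : w ∈ supportedIn (supp xs) := hS ▸ mem_supportedIn_supp w
  have hwV := Submodule.sub_mem _ hwS (mem_supportedIn_supp xs)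
  have key : ∀ M ∈ genHessE f lam q w, ∀ d, IsNewtonDirection f lam q w M d →
      (‖w - d - xs‖ ≤ C * ‖w - xs‖ ^ 2 ∧ ‖w - d - xs‖ ≤ 1 / 2 * ‖w - xs‖ ∧
        w - d ∈ supportedIn (supp xs)) ∧ 0 ∈ newtonExponents f lam q σ γ w d := by
    intro M hM d hd
    obtain ⟨hdS, hN⟩ := hd.mem_and_inner hf hM
    rw [hS] at hdS hN
    have hwd := Submodule.sub_mem _ hwS hdS
    obtain ⟨h1, h2, h3⟩ := H w hw hwV d hdS hN
    refine ⟨⟨h1, h1.trans ?_, hwd⟩, ?_⟩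
    · rw [sq, ← mul_assoc]
      exact mul_le_mul_of_nonneg_right h2 (norm_nonneg _)
    · change objF f lam q (w - γ ^ 0 • d) ≤ objF f lam q w - σ / 2 * ‖γ ^ 0 • d‖ ^ 2
      rwa [pow_zero, one_smul, objF_eq_objE f lam q hwd, objF_eq_objE f lam q hwS]
  -- Exponent 0 passes the test, so it is the least one; coercivity at `w` makes the equations
  -- solvable. Both fallback cases are thus impossible.
  obtain ⟨-, M, hM, ⟨d, hd, s, hs, rfl⟩ | ⟨hno | ⟨d, hd, he⟩, rfl⟩⟩ := hstep
  · obtain ⟨h1, h0⟩ := key M hM d hd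
    have hs0 : s = 0 := Nat.le_zero.1 (hs.2 h0)
    rwa [hs0, pow_zero, one_smul]
  · refine absurd (exists_isNewtonDirection hf hM fun v hv hv0 => ?_) hno
    rw [hS] at hv ⊢
    have hvn := norm_pos_iff.2 hv0
    exact lt_of_lt_of_le (by positivity) (h.coercive _ hwr v hv)
  · have := (key M hM d hd).2
    rw [he] at this
    exact this.elim

/-- A limit of proximal points with stable support is stationary on its support. -/
lemma inner_gradient_objE_eq_zero_of_tendsto (hf : ContDiff ℝ 3 f) (hα : 0 < α) {xs : Vec n}
    {x w : ℕ → Vec n} (hx : Tendsto x atTop (𝓝 xs)) (hw : Tendsto w atTop (𝓝 xs))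
    (hp : ∀ k, w k ∈ prox (fun z => α * lam * lq q z) (x k - α • gradient f (x k)))
    (hS : ∀ᶠ k in atTop, supp (w k) = supp xs) {v : Vec n} (hv : v ∈ supportedIn (supp xs)) :
    ⟪gradient (objE f lam q (supp xs)) xs, v⟫_ℝ = 0 := by
  have hG : ContinuousAt (gradient f) xs :=
    (contDiffAt_gradient (l := 2) hf.contDiffAt (by norm_num)).continuousAt
  have hGE : ContinuousAt (gradient (objE f lam q (supp xs))) xs :=
    (contDiffAt_gradient (l := 2) (contDiffAt_objE hf lam q fun i hi => mem_supp.1 hi)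
      (by norm_num)).continuousAt
  have h1 : Tendsto (fun k => α * ⟪gradient (objE f lam q (supp xs)) (w k), v⟫_ℝ) atTop
      (𝓝 (α * ⟪gradient (objE f lam q (supp xs)) xs, v⟫_ℝ)) :=
    ((hGE.tendsto.comp hw).inner tendsto_const_nhds).const_mul α
  have h2 : Tendsto (fun k => ⟪α • (gradient f (w k) - gradient f (x k)) - (w k - x k), v⟫_ℝ)
      atTop (𝓝 ⟪α • (gradient f xs - gradient f xs) - (xs - xs), v⟫_ℝ) :=
    (((((hG.tendsto.comp hw).sub (hG.tendsto.comp hx)).const_smul α).sub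
      (hw.sub hx)).inner tendsto_const_nhds)
  have h3 := tendsto_nhds_unique (h1.congr' (by
    filter_upwards [hS] with k hk
    rw [← hk]
    exact inner_gradient_objE_of_mem_prox hf (hp k) (hk.symm ▸ hv))) h2
  simpa [hα.ne'] using h3

end Step

/-! ### Global convergence and the quadratic rate -/

section Convergence

variable {n : ℕ} {f : Vec n → ℝ} {μ lam q σ γ α : ℝ}

/-- Vanishing proximal steps: the objective values decrease and are bounded below. -/
lemma tendsto_sub_zero_of_decrease (hσ : 0 < σ) {F : Vec n → ℝ} (hF : ∀ x, 0 ≤ F x)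
    {x w : ℕ → Vec n} (hdec : ∀ k, F (w k) ≤ F (x k) - σ / 2 * ‖w k - x k‖ ^ 2)
    (hnext : ∀ k, F (x (k + 1)) ≤ F (w k)) : Tendsto (fun k => w k - x k) atTop (𝓝 0) := by
  have hanti : Antitone fun k => F (x k) := antitone_nat_of_succ_le fun k => by
    have : 0 ≤ σ / 2 * ‖w k - x k‖ ^ 2 := by positivity
    linarith [hdec k, hnext k]
  have hlim := tendsto_atTop_ciInf hanti ⟨0, by rintro _ ⟨k, rfl⟩; exact hF _⟩
  have hdiff := (hlim.sub (hlim.comp (tendsto_add_atTop_nat 1))).const_mul (2 / σ)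
  rw [sub_self, mul_zero] at hdiff
  have hsq : Tendsto (fun k => ‖w k - x k‖ ^ 2) atTop (𝓝 0) := by
    refine squeeze_zero (fun k => sq_nonneg _) (fun k => ?_) hdiff
    simp only [Function.comp_apply]
    rw [div_mul_eq_mul_div, le_div_iff₀ hσ]
    linarith [hdec k, hnext k]
  refine tendsto_zero_iff_norm_tendsto_zero.2 ?_
  simpa using hsq.sqrt

/-- If `w k - x k → 0` and `x (k + 1)` is closer to a cluster point of `x` by a factor `1 / 2` than
`w k` whenever `w k` is near it, then `x` converges to that cluster point. -/
lemma tendsto_of_mapClusterPt_of_contraction {x w : ℕ → Vec n} {xs : Vec n}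
    (hx : MapClusterPt xs atTop x) (hwx : Tendsto (fun k => w k - x k) atTop (𝓝 0))
    (hloc : ∀ᶠ y in 𝓝 xs, ∀ k, w k = y → ‖x (k + 1) - xs‖ ≤ 1 / 2 * ‖w k - xs‖) :
    Tendsto x atTop (𝓝 xs) := by
  obtain ⟨δ₀, hδ₀, H⟩ := Metric.eventually_nhds_iff_ball.1 hloc
  refine Metric.tendsto_atTop.2 fun ε hε => ?_
  set δ := min δ₀ ε with hδ
  have hδpos : 0 < δ := by positivity
  obtain ⟨K, hK⟩ := eventually_atTop.1
    (hwx.norm.eventually (gt_mem_nhds (show ‖(0 : Vec n)‖ < δ / 2 by simpa using half_pos hδpos)))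
  obtain ⟨N, hN, hKN⟩ := ((hx.frequently (Metric.ball_mem_nhds xs (half_pos hδpos))).and_eventually
    (eventually_ge_atTop K)).exists
  -- The proximal step moves less than δ/2, so `w k` is within δ; halving brings the next iterate
  -- back within δ/2.
  have htrap : ∀ k ≥ N, ‖x k - xs‖ < δ / 2 := by
    intro k hk
    induction k, hk using Nat.le_induction with
    | base => rwa [← mem_ball_iff_norm]
    | succ k hk ih =>
      have h1 : ‖w k - xs‖ < δ := by
        have := norm_add_le (w k - x k) (x k - xs)
        rw [sub_add_sub_cancel] at this
        linarith [hK k (hKN.trans hk)]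
      have h2 := H (w k) (by rw [mem_ball_iff_norm]; exact h1.trans_le (min_le_left _ _)) k rfl
      linarith
  refine ⟨N, fun k hk => ?_⟩
  rw [dist_eq_norm]
  linarith [htrap k hk, min_le_right δ₀ ε]

/-- Convergence of PSNP for a `C³` coercive `f`, given sufficient decrease of the proximal phase. For
`σ > 0` the bound `σ < σ_*` already contains the second-order sufficient condition. -/
theorem psnp_convergence (hf : ContDiff ℝ 3 f) (hμ : 0 < μ)
    (hcoer : ∀ x, μ / 2 * ‖x‖ ^ 2 ≤ f x) (hlam : 0 < lam) (hq1 : q < 1) (hσ : 0 < σ)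
    (hα : 0 < α) {x w : ℕ → Vec n} (hstep : ∀ k, IsStep f lam q σ γ α (x k) (w k) (x (k + 1)))
    (hdec : ∀ k, objF f lam q (w k) ≤ objF f lam q (x k) - σ / 2 * ‖w k - x k‖ ^ 2)
    {xs : Vec n} (hx : MapClusterPt xs atTop x) (hσs : (σ : EReal) < sigmaStar f lam q xs) :
    Tendsto x atTop (𝓝 xs) ∧ IsUniqueLocalMinimizer (objF f lam q) xs ∧
      ∃ C : ℝ, 0 < C ∧ ∀ᶠ k in atTop, ‖x (k + 1) - xs‖ ≤ C * ‖x k - xs‖ ^ 2 := by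
  have hnext : ∀ k, objF f lam q (x (k + 1)) ≤ objF f lam q (w k) := fun k =>
    (hstep k).objF_le hσ
  have hFpos : ∀ y, 0 ≤ objF f lam q y := fun y =>
    add_nonneg (le_trans (by positivity) (hcoer y)) (mul_nonneg hlam.le (lq_nonneg q y))
  have hFw : ∀ k, objF f lam q (w k) ≤ objF f lam q (x k) := fun k => by
    have : 0 ≤ σ / 2 * ‖w k - x k‖ ^ 2 := by positivity
    linarith [hdec k]
  have hlevel : ∀ k, objF f lam q (x k) ≤ objF f lam q (x 0) := fun k =>
    antitone_nat_of_succ_le (f := fun k => objF f lam q (x k))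
      (fun k => (hnext k).trans (hFw k)) (Nat.zero_le k)
  have hwx := tendsto_sub_zero_of_decrease hσ hFpos hdec hnext
  have hG : Continuous (gradient f) := continuous_iff_continuousAt.2 fun x =>
    (contDiffAt_gradient (l := 2) hf.contDiffAt (by norm_num)).continuousAt
  obtain ⟨U, hU⟩ := (isCompact_closedBall (0 : Vec n)
    (√(2 / μ * objF f lam q (x 0)))).exists_bound_of_continuousOn
    (f := fun y => y - α • gradient f y) (continuous_id.sub (hG.const_smul α)).continuousOn
  obtain ⟨c, hc, hlow⟩ := exists_le_abs_of_mem_prox (n := n) hq1 (mul_pos hα hlam) U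
  have hwc : ∀ k i, w k i ≠ 0 → c ≤ |w k i| := fun k =>
    hlow _ _ (hU (x k) (by simpa using norm_le_of_objF_le hμ hlam hcoer (hlevel k)))
      (hstep k).1
  have hsupp : ∀ᶠ y in 𝓝 xs, ∀ k, w k = y → supp (w k) = supp xs := by
    filter_upwards [eventually_supp_eq xs hc] with y hy k hk
    subst hk
    exact hy (hwc k)
  obtain ⟨r, L, hctrl⟩ := exists_localControl hσ
    (contDiffAt_objE hf lam q fun i hi => mem_supp.1 hi)
    fun v hv => le_inner_hessOp_of_lt_sigmaStar hf hσs hv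
  have hstat : ∀ v ∈ supportedIn (supp xs),
      ⟪gradient (objE f lam q (supp xs)) xs, v⟫_ℝ = 0 := by
    intro v hv
    obtain ⟨ψ, hψ, hxψ⟩ := hx.tendsto_subseq
    have hwψ : Tendsto (w ∘ ψ) atTop (𝓝 xs) := by
      simpa [Function.comp_def] using (hwx.comp hψ.tendsto_atTop).add hxψ
    exact inner_gradient_objE_eq_zero_of_tendsto hf hα hxψ hwψ (fun k => (hstep (ψ k)).1)
      ((hwψ.eventually hsupp).mono fun k hk => hk (ψ k) rfl) hv
  have hmin := isUniqueLocalMinimizer_of_localControl hq1 hlam hσ hctrl hstat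
  obtain ⟨C, hC, hnewton⟩ := exists_newton_contraction (γ := γ) (α := α) hf hσ hctrl hstat
  have hconv : Tendsto x atTop (𝓝 xs) := by
    refine tendsto_of_mapClusterPt_of_contraction hx hwx ?_
    filter_upwards [hsupp, hnewton] with y h1 h2 k hk
    have h3 := h1 k hk
    subst hk
    exact (h2 h3 _ _ (hstep k)).2.1
  have hwconv : Tendsto w atTop (𝓝 xs) := by simpa using hwx.add hconv
  have hnear : ∀ᶠ k in atTop, ‖x (k + 1) - xs‖ ≤ C * ‖w k - xs‖ ^ 2 ∧
      x (k + 1) ∈ supportedIn (supp xs) := by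
    filter_upwards [hwconv.eventually hsupp, hwconv.eventually hnewton] with k h1 h2
    have h3 := h2 (h1 k rfl) _ _ (hstep k)
    exact ⟨h3.1, h3.2.2⟩
  -- Needed for the upper bound on F(x^k) - F(x*), which comes from smoothness of E and holds for F
  -- only on this subspace.
  have hxsupp : ∀ᶠ k in atTop, x k ∈ supportedIn (supp xs) := by
    obtain ⟨N, hN⟩ := eventually_atTop.1 hnear
    filter_upwards [eventually_ge_atTop (N + 1)] with k hk
    obtain ⟨j, rfl⟩ := Nat.exists_eq_add_of_le' (Nat.le_of_add_left_le hk)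
    exact (hN j (by omega)).2
  refine ⟨hconv, hmin, ?_⟩
  obtain ⟨η, hη, hgrow⟩ := hmin
  have hL := hctrl.L_pos
  -- Growth at `w k`, monotonicity of F and smoothness at `x k` give ‖w k - xs‖² ≤ (L/2/η)‖x k -
  -- xs‖².
  refine ⟨C * (L / 2 / η), by positivity, ?_⟩
  filter_upwards [hnear, hxsupp, hwconv.eventually hgrow,
    hconv.eventually (Metric.ball_mem_nhds xs hctrl.r_pos)] with k h1 h2 h3 h4
  have hxsS := mem_supportedIn_supp xs
  have h5 := hctrl.smoothness (Metric.mem_ball_self hctrl.r_pos) h4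
  rw [hstat _ (Submodule.sub_mem _ h2 hxsS), ← objF_eq_objE f lam q h2,
    ← objF_eq_objE f lam q hxsS] at h5
  refine h1.1.trans ?_
  rw [mul_assoc]
  refine mul_le_mul_of_nonneg_left ?_ hC.le
  rw [div_mul_eq_mul_div, le_div_iff₀ hη]
  linarith [hFw k]

end Convergence

end PSNP

/-! ### Assembly for regularized logistic regression -/

theorem mainTheorem10 {n m : ℕ} (hm : 0 < m)
    (a : Fin m → PSNP.Vec n) (b : Fin m → ℝ) (hb : ∀ i, b i = 0 ∨ b i = 1)
    (μ lam q : ℝ) (hμ : 0 < μ) (hlam : 0 < lam) (hq0 : 0 ≤ q) (hq1 : q < 1)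
    -- parameters of the algorithm
    (σ γ τ σ₀ α : ℝ) (hσ : 0 < σ) (hγ0 : 0 < γ) (hγ1 : γ < 1) (hτ : 0 < τ)
    -- the iterates, from an arbitrary starting point `x 0`
    (x w : ℕ → PSNP.Vec n)
    (hσ₀ : σ₀ = PSNP.sigma0 (PSNP.flr a b μ) lam q τ (x 0) ∨
      PSNP.IsStronglySmooth σ₀ (PSNP.flr a b μ))
    (hα0 : 0 < α) (hα : α ≤ min τ (1 / (σ + σ₀)))
    (hstep : ∀ k, PSNP.IsStep (PSNP.flr a b μ) lam q σ γ α (x k) (w k) (x (k + 1)))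
    -- an accumulation point of the iterates
    (xstar : PSNP.Vec n) (hx : MapClusterPt xstar Filter.atTop x)
    (hsosc : PSNP.SecondOrderSufficient (PSNP.flr a b μ) lam q xstar)
    (hσstar : (σ : EReal) < PSNP.sigmaStar (PSNP.flr a b μ) lam q xstar) :
    (∀ k, PSNP.objF (PSNP.flr a b μ) lam q (w k) ≤
      PSNP.objF (PSNP.flr a b μ) lam q (x k) - σ / 2 * ‖w k - x k‖ ^ 2) ∧
    Filter.Tendsto x Filter.atTop (nhds xstar) ∧
    PSNP.IsUniqueLocalMinimizer (PSNP.objF (PSNP.flr a b μ) lam q) xstar ∧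
    ∃ C : ℝ, 0 < C ∧ ∀ᶠ k in Filter.atTop, ‖x (k + 1) - xstar‖ ≤ C * ‖x k - xstar‖ ^ 2 := by
  have hf := PSNP.contDiff_flr a b μ
  have hcoer := PSNP.le_flr a hb μ
  obtain ⟨hατ, hαs⟩ := le_min_iff.1 hα
  -- No sign of σ₀ is assumed; a positive step size already forces this.
  have hpos : 0 < σ + σ₀ := one_div_pos.1 (hα0.trans_le hαs)
  have hαs' : α * (σ + σ₀) ≤ 1 := (le_div_iff₀ hpos).1 hαs
  -- The supremum σ₀ controls only steps from the initial level set, so decrease is first proved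
  -- conditionally and then alternates with level-set membership in an induction.
  have hdec_of_level : ∀ k, PSNP.objF (PSNP.flr a b μ) lam q (x k) ≤
      PSNP.objF (PSNP.flr a b μ) lam q (x 0) → PSNP.objF (PSNP.flr a b μ) lam q (w k) ≤
        PSNP.objF (PSNP.flr a b μ) lam q (x k) - σ / 2 * ‖w k - x k‖ ^ 2 := by
    intro k hk
    refine PSNP.objF_le_of_mem_prox hα0 hαs' (hstep k).1 ?_
    rcases hσ₀ with rfl | hs
    · exact PSNP.le_taylor_sigma0 hf hμ hlam hq0 hq1 hα0 hατ hcoer hk (hstep k).1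
    · exact hs _ _
  have hlevel : ∀ k, PSNP.objF (PSNP.flr a b μ) lam q (x k) ≤
      PSNP.objF (PSNP.flr a b μ) lam q (x 0) := by
    intro k
    induction k with
    | zero => exact le_rfl
    | succ k ih =>
      have h0 : 0 ≤ σ / 2 * ‖w k - x k‖ ^ 2 := by positivity
      linarith [(hstep k).objF_le hσ, hdec_of_level k ih]
  have hdec := fun k => hdec_of_level k (hlevel k)
  exact ⟨hdec, PSNP.psnp_convergence hf hμ hcoer hlam hq1 hσ hα0 hstep hdec hx hσstar⟩
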